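/- Let $(X,\mathcal F(X))$ be a measurable space, let $\mathcal H$ be a complex Hilbert space of finite dimension $d$, and let $\nu:\mathcal F(X)\to\mathcal B(\mathcal H)$ be a quantum probability measure, that is, a (countably additive) positive operator-valued measure with $\nu(X)=1\neq 0$. Let $\mu=\frac1d\,\mathrm{tr}\circ\nu$ be the induced classical probability measure, and let $L^\infty_{\mathcal H}(X,\nu)=L^\infty(X,\mu)\,\overline\otimes\,\mathcal B(\mathcal H)$ be the unital C$^*$-algebra of ($\mu$-a.e. classes of) $\mu$-essentially bounded measurable functions $\psi:X\to\mathcal B(\mathcal H)$. The essential range $\operatorname{ess-ran}\psi$ is the set of all $\lambda\in\mathcal B(\mathcal H)$ such that $\mu(\psi^{-1}(U))>0$ for every neighbourhood $U$ of $\lambda$. For an element $a$ of a unital C$^*$-algebra, $\mathrm{Spec}^d(a)\subseteq M_d(\mathbb C)$ is the Gelfand spectrum, the set of all $\varrho(a)$ where $\varrho:\mathrm C^*(a)\to M_d(\mathbb C)$ is a unital $*$-homomorphism on the unital C$^*$-subalgebra $\mathrm C^*(a)$ generated by $a$. A nonempty compact set $Q\subset\mathcal B(\mathcal H)$ is hypoconvex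 if (i) $u^*\lambda u\in Q$ for all unitaries $u\in\mathcal B(\mathcal H)$ and $\lambda\in Q$, and (ii) $\sum_{j=1}^m p_j\lambda_j\in Q$ for all $\lambda_1,\dots,\lambda_m\in Q$ and all projections $p_1,\dots,p_m\in\mathcal B(\mathcal H)$ with $p_1+\cdots+p_m=1$ and $p_j\lambda_j=\lambda_jp_j$ for each $j$. The hypoconvex hull $Q^\sim$ of a nonempty compact set $Q$ is the smallest hypoconvex set containing $Q$. Theorem. Let $\psi\in L^\infty_{\mathcal H}(X,\nu)$. For every $\lambda\in M_d(\mathbb C)$, the following are equivalent: (1) $\lambda\in\mathrm{Spec}^d(\psi)$; (2) there exists a unitary $v:\mathbb C^d\to\mathcal H$ such that $v\lambda v^{-1}\in(\operatorname{ess-ran}\psi)^\sim$. Moreover, $v\,\mathrm{Spec}^d(\psi)\,v^{-1}=(\operatorname{ess-ran}\psi)^\sim$ for every unitary $v:\mathbb C^d\to\mathcal H$. -/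

import Mathlib

open MeasureTheory
open scoped ENNReal Topology

/-! ### Quantum probability measures and the induced classical measure -/

/-- A quantum probability measure on `X` with values in `B(H)`: a positive operator-valued
measure `ν` with `ν(X) ≠ 0` that is normalised by `ν(X) = 1`. It is used for finite-dimensional
`H` only, where the ultraweak topology of `B(H)` is the norm topology, so that ultraweak countable
additivity is countable additivity as a vector measure with values in `B(H)`. -/
structure QuantumProbabilityMeasure (X : Type*) [MeasurableSpace X] (H : Type*)
    [NormedAddCommGroup H] [InnerProductSpace ℂ H] [CompleteSpace H]
    extends VectorMeasure X (H →L[ℂ] H) where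
  isPositive' : ∀ E : Set X, MeasurableSet E → (toVectorMeasure E).IsPositive
  univ_ne_zero' : toVectorMeasure Set.univ ≠ 0
  univ_eq_one' : toVectorMeasure Set.univ = 1

namespace QuantumProbabilityMeasure

variable {X : Type*} [MeasurableSpace X] {H : Type*} [NormedAddCommGroup H]
  [InnerProductSpace ℂ H] [CompleteSpace H]

/-- The number `(1/d) tr (ν E)`, where `d = dim H`. (The trace of a positive operator is real.) -/
noncomputable def normalizedTrace (ν : QuantumProbabilityMeasure X H) (E : Set X) : ℝ :=
  (LinearMap.trace ℂ H (ν.toVectorMeasure E : H →ₗ[ℂ] H)).re / (Module.finrank ℂ H : ℝ)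

theorem normalizedTrace_nonneg (ν : QuantumProbabilityMeasure X H) {E : Set X}
    (hE : MeasurableSet E) : 0 ≤ ν.normalizedTrace E := by
  have h := (ContinuousLinearMap.IsPositive.toLinearMap _ (ν.isPositive' E hE)).trace_nonneg
  exact div_nonneg (Complex.le_def.1 h).1 (Nat.cast_nonneg _)

theorem hasSum_normalizedTrace [FiniteDimensional ℂ H] (ν : QuantumProbabilityMeasure X H)
    {f : ℕ → Set X} (hf : ∀ i, MeasurableSet (f i)) (hd : Pairwise (Function.onFun Disjoint f)) :
    HasSum (fun i => ν.normalizedTrace (f i)) (ν.normalizedTrace (⋃ i, f i)) := by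
  let T : (H →L[ℂ] H) →L[ℂ] ℂ := LinearMap.toContinuousLinearMap
    ((LinearMap.trace ℂ H).comp (ContinuousLinearMap.coeLM ℂ : (H →L[ℂ] H) →ₗ[ℂ] (H →ₗ[ℂ] H)))
  have h1 : HasSum (fun i => T (ν.toVectorMeasure (f i))) (T (ν.toVectorMeasure (⋃ i, f i))) :=
    (ν.toVectorMeasure.m_iUnion hf hd).mapL T
  exact (Complex.hasSum_re h1).div_const _

/-- The classical measure `μ = (1/d) tr ∘ ν` induced by `ν`, where `d = dim H`. -/
noncomputable def inducedMeasure [FiniteDimensional ℂ H] (ν : QuantumProbabilityMeasure X H) :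
    Measure X :=
  Measure.ofMeasurable (fun E _ => ENNReal.ofReal (ν.normalizedTrace E))
    (by simp [normalizedTrace])
    (fun f hf hd => by
      have h := ν.hasSum_normalizedTrace hf hd
      rw [← h.tsum_eq]
      exact ENNReal.ofReal_tsum_of_nonneg (fun n => ν.normalizedTrace_nonneg (hf n)) h.summable)

theorem inducedMeasure_apply [FiniteDimensional ℂ H] (ν : QuantumProbabilityMeasure X H)
    {E : Set X} (hE : MeasurableSet E) :
    ν.inducedMeasure E = ENNReal.ofReal (ν.normalizedTrace E) :=
  Measure.ofMeasurable_apply E hE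

end QuantumProbabilityMeasure

/-! ### The C⋆-algebra of essentially bounded functions with values in a C⋆-algebra

The underlying normed space is Mathlib's `Lp A ∞ μ` with the essential supremum norm; product,
unit, adjoint and scalars are defined pointwise almost everywhere. -/

namespace LInfty

variable {X : Type*} [MeasurableSpace X] {μ : Measure X} {A : Type*} [CStarAlgebra A]

noncomputable instance instMul : Mul (Lp A ∞ μ) where
  mul f g := ((Lp.memLp g).mul (Lp.memLp f) : MemLp (⇑f * ⇑g) ∞ μ).toLp (⇑f * ⇑g)

noncomputable instance instOne : One (Lp A ∞ μ) where
  one := (memLp_top_const (1 : A)).toLp (fun _ => (1 : A))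

theorem coeFn_mul (f g : Lp A ∞ μ) : ⇑(f * g) =ᵐ[μ] fun x => f x * g x :=
  MemLp.coeFn_toLp ((Lp.memLp g).mul (Lp.memLp f) : MemLp (⇑f * ⇑g) ∞ μ)

theorem coeFn_one : ⇑(1 : Lp A ∞ μ) =ᵐ[μ] fun _ => (1 : A) :=
  MemLp.coeFn_toLp (memLp_top_const (1 : A))

theorem coeFn_star (f : Lp A ∞ μ) : ⇑(star f) =ᵐ[μ] fun x => star (f x) :=
  Lp.coeFn_star f

theorem ae_norm_le (f : Lp A ∞ μ) : ∀ᵐ x ∂μ, ‖f x‖ ≤ ‖f‖ := by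
  filter_upwards [ae_le_eLpNormEssSup (f := ⇑f) (μ := μ)] with x hx
  rw [← eLpNorm_exponent_top, ← Lp.enorm_def] at hx
  exact enorm_le_iff_norm_le.1 hx

theorem norm_le_of_ae_bound {f : Lp A ∞ μ} {C : ℝ} (hC : 0 ≤ C) (h : ∀ᵐ x ∂μ, ‖f x‖ ≤ C) :
    ‖f‖ ≤ C := by
  rw [Lp.norm_def, eLpNorm_exponent_top]
  exact ENNReal.toReal_le_of_le_ofReal hC (eLpNormEssSup_le_of_ae_bound h)

noncomputable instance instRing : Ring (Lp A ∞ μ) :=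
  { (inferInstance : AddCommGroup (Lp A ∞ μ)), instMul, instOne with
    left_distrib := fun f g h => Lp.ext <| by
      filter_upwards [coeFn_mul f (g + h), Lp.coeFn_add g h, coeFn_mul f g, coeFn_mul f h,
        Lp.coeFn_add (f * g) (f * h)] with x h1 h2 h3 h4 h5
      simp only [h1, h2, h3, h4, h5, Pi.add_apply, mul_add]
    right_distrib := fun f g h => Lp.ext <| by
      filter_upwards [coeFn_mul (f + g) h, Lp.coeFn_add f g, coeFn_mul f h, coeFn_mul g h,
        Lp.coeFn_add (f * h) (g * h)] with x h1 h2 h3 h4 h5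
      simp only [h1, h2, h3, h4, h5, Pi.add_apply, add_mul]
    zero_mul := fun f => Lp.ext <| by
      filter_upwards [coeFn_mul 0 f, Lp.coeFn_zero A ∞ μ] with x h1 h2
      simp only [h1, h2, Pi.zero_apply, zero_mul]
    mul_zero := fun f => Lp.ext <| by
      filter_upwards [coeFn_mul f 0, Lp.coeFn_zero A ∞ μ] with x h1 h2
      simp only [h1, h2, Pi.zero_apply, mul_zero]
    mul_assoc := fun f g h => Lp.ext <| by
      filter_upwards [coeFn_mul (f * g) h, coeFn_mul f g, coeFn_mul f (g * h),
        coeFn_mul g h] with x h1 h2 h3 h4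
      simp only [h1, h2, h3, h4, mul_assoc]
    one_mul := fun f => Lp.ext <| by
      filter_upwards [coeFn_mul 1 f, coeFn_one (A := A) (μ := μ)] with x h1 h2
      simp only [h1, h2, one_mul]
    mul_one := fun f => Lp.ext <| by
      filter_upwards [coeFn_mul f 1, coeFn_one (A := A) (μ := μ)] with x h1 h2
      simp only [h1, h2, mul_one] }

noncomputable instance instNormedRing : NormedRing (Lp A ∞ μ) :=
  { instRing, (inferInstance : NormedAddCommGroup (Lp A ∞ μ)) with
    norm_mul_le := fun f g => by
      refine norm_le_of_ae_bound (by positivity) ?_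
      filter_upwards [coeFn_mul f g, ae_norm_le f, ae_norm_le g] with x h1 h2 h3
      rw [h1]
      exact (norm_mul_le _ _).trans (by gcongr) }

noncomputable instance instStarRing : StarRing (Lp A ∞ μ) where
  star_mul f g := Lp.ext <| by
    filter_upwards [coeFn_star (f * g), coeFn_mul f g, coeFn_mul (star g) (star f),
      coeFn_star f, coeFn_star g] with x h1 h2 h3 h4 h5
    simp only [h1, h2, h3, h4, h5, star_mul]
  star_add f g := Lp.ext <| by
    filter_upwards [coeFn_star (f + g), Lp.coeFn_add f g, Lp.coeFn_add (star f) (star g),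
      coeFn_star f, coeFn_star g] with x h1 h2 h3 h4 h5
    simp only [h1, h2, h3, h4, h5, Pi.add_apply, star_add]

instance instCStarRing : CStarRing (Lp A ∞ μ) where
  norm_mul_self_le f := by
    have h : ‖f‖ ≤ Real.sqrt ‖star f * f‖ := by
      refine norm_le_of_ae_bound (Real.sqrt_nonneg _) ?_
      filter_upwards [coeFn_star f, coeFn_mul (star f) f, ae_norm_le (star f * f)] with x h1 h2 h3
      rw [h2, h1, CStarRing.norm_star_mul_self] at h3
      exact Real.le_sqrt_of_sq_le (by rw [sq]; exact h3)
    calc ‖f‖ * ‖f‖ ≤ Real.sqrt ‖star f * f‖ * Real.sqrt ‖star f * f‖ := by gcongr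
      _ = ‖star f * f‖ := Real.mul_self_sqrt (norm_nonneg _)

noncomputable instance instAlgebra : Algebra ℂ (Lp A ∞ μ) :=
  Algebra.ofModule
    (fun c f g => Lp.ext <| by
      filter_upwards [coeFn_mul (c • f) g, Lp.coeFn_smul c f, Lp.coeFn_smul c (f * g),
        coeFn_mul f g] with x h1 h2 h3 h4
      simp only [h1, h2, h3, h4, Pi.smul_apply, smul_mul_assoc])
    (fun c f g => Lp.ext <| by
      filter_upwards [coeFn_mul f (c • g), Lp.coeFn_smul c g, Lp.coeFn_smul c (f * g),
        coeFn_mul f g] with x h1 h2 h3 h4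
      simp only [h1, h2, h3, h4, Pi.smul_apply, mul_smul_comm])

noncomputable instance instNormedAlgebra : NormedAlgebra ℂ (Lp A ∞ μ) :=
  { instAlgebra with norm_smul_le := fun c f => norm_smul_le c f }

instance instStarModule : StarModule ℂ (Lp A ∞ μ) where
  star_smul c f := Lp.ext <| by
    filter_upwards [coeFn_star (c • f), Lp.coeFn_smul c f, Lp.coeFn_smul (star c) (star f),
      coeFn_star f] with x h1 h2 h3 h4
    simp only [h1, h2, h3, h4, Pi.smul_apply, star_smul]

noncomputable instance instCStarAlgebra : CStarAlgebra (Lp A ∞ μ) where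

end LInfty

/-! ### Gelfand spectrum, essential range, hypoconvex hull -/

/-- `L^∞_H(X, ν) = L^∞(X, μ) ⊗ B(H)`, realised as the C⋆-algebra of (classes modulo `μ`-null sets
of) essentially bounded quantum random variables `X → B(H)`, where `μ` is induced by `ν`. -/
abbrev QuantumLInfty {X : Type*} [MeasurableSpace X] {H : Type*} [NormedAddCommGroup H]
    [InnerProductSpace ℂ H] [CompleteSpace H] [FiniteDimensional ℂ H]
    (ν : QuantumProbabilityMeasure X H) : Type _ :=
  Lp (H →L[ℂ] H) ∞ ν.inducedMeasure

/-- The Gelfand spectrum `Spec^d(a)`: all `ρ(a)`, where `ρ` runs through the unital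
⋆-homomorphisms from the unital C⋆-subalgebra generated by `a` to `M_d(ℂ)`. -/
def gelfandSpectrum (d : ℕ) {A : Type*} [CStarAlgebra A] (a : A) :
    Set (Matrix (Fin d) (Fin d) ℂ) :=
  {l | ∃ ρ : StarAlgebra.elemental ℂ a →⋆ₐ[ℂ] Matrix (Fin d) (Fin d) ℂ,
    ρ ⟨a, StarAlgebra.elemental.self_mem ℂ a⟩ = l}

/-- The essential range of a function with respect to a measure. -/
def essRange {X : Type*} [MeasurableSpace X] {B : Type*} [TopologicalSpace B] (μ : Measure X)
    (f : X → B) : Set B :=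
  {l | ∀ U ∈ 𝓝 l, 0 < μ (f ⁻¹' U)}

/-- The essential range depends on the function up to null sets only. -/
theorem essRange_congr_ae {X : Type*} [MeasurableSpace X] {B : Type*} [TopologicalSpace B]
    {μ : Measure X} {f g : X → B} (h : f =ᵐ[μ] g) : essRange μ f = essRange μ g := by
  ext l
  have key : ∀ U : Set B, μ (f ⁻¹' U) = μ (g ⁻¹' U) := fun U => measure_congr <| by
    filter_upwards [h] with x hx
    exact propext (by change f x ∈ U ↔ g x ∈ U; rw [hx])
  simp only [essRange, Set.mem_ofPred_eq, key]

section Hypoconvex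

variable {H : Type*} [NormedAddCommGroup H] [InnerProductSpace ℂ H] [CompleteSpace H]

/-- Hypoconvex subsets of `B(H)`. -/
structure IsHypoconvex (Q : Set (H →L[ℂ] H)) : Prop where
  nonempty : Q.Nonempty
  isCompact : IsCompact Q
  star_mul_mul_mem : ∀ u ∈ unitary (H →L[ℂ] H), ∀ l ∈ Q, star u * l * u ∈ Q
  sum_mem : ∀ (m : ℕ) (l p : Fin m → (H →L[ℂ] H)), (∀ j, l j ∈ Q) →
    (∀ j, IsStarProjection (p j)) → ∑ j, p j = 1 → (∀ j, p j * l j = l j * p j) →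
    ∑ j, p j * l j ∈ Q

/-- The hypoconvex hull of a nonempty compact set: the smallest hypoconvex set containing it,
obtained as the intersection of all of them. -/
def hypoconvexHull (Q : Set (H →L[ℂ] H)) : Set (H →L[ℂ] H) :=
  ⋂₀ {R | IsHypoconvex R ∧ Q ⊆ R}

theorem norm_sum_le_of_isStarProjection {m : ℕ} {l p : Fin m → (H →L[ℂ] H)} {R : ℝ} (hR : 0 ≤ R)
    (hl : ∀ j, ‖l j‖ ≤ R) (hp : ∀ j, IsStarProjection (p j)) (hs : ∑ j, p j = 1)
    (hc : ∀ j, p j * l j = l j * p j) : ‖∑ j, p j * l j‖ ≤ R := by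
  have hadj : ∀ j (a b : H), inner ℂ (p j a) b = inner ℂ a (p j b) := fun j a b => by
    have h := ContinuousLinearMap.adjoint_inner_left (p j) b a
    rwa [← ContinuousLinearMap.star_eq_adjoint, (hp j).isSelfAdjoint.star_eq] at h
  have hidem : ∀ j (a : H), p j (p j a) = p j a := fun j a =>
    congrArg (fun q : H →L[ℂ] H => q a) (hp j).isIdempotentElem
  have hcomm : ∀ j (a : H), p j (l j a) = l j (p j a) := fun j a =>
    congrArg (fun q : H →L[ℂ] H => q a) (hc j)
  have hsq : ∀ a : H, ∑ j, ‖p j a‖ ^ 2 = ‖a‖ ^ 2 := fun a => by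
    have h1 : ∑ j, p j a = a := by
      have := congrArg (fun q : H →L[ℂ] H => q a) hs
      simpa [sum_apply] using this
    have h2 : ∀ j, ((‖p j a‖ ^ 2 : ℝ) : ℂ) = inner ℂ (p j a) a := fun j => by
      rw [← hidem j a, hadj j (p j a) a, hidem, inner_self_eq_norm_sq_to_K]
      push_cast
      rfl
    have h3 : ((∑ j, ‖p j a‖ ^ 2 : ℝ) : ℂ) = ((‖a‖ ^ 2 : ℝ) : ℂ) := by
      rw [Complex.ofReal_sum, Finset.sum_congr rfl fun j _ => h2 j, ← sum_inner, h1,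
        inner_self_eq_norm_sq_to_K]
      push_cast
      rfl
    exact_mod_cast h3
  have hform : ∀ x y : H, ‖(inner ℂ ((∑ j, p j * l j) x) y : ℂ)‖ ≤ R * ‖x‖ * ‖y‖ := fun x y => by
    have h1 : (inner ℂ ((∑ j, p j * l j) x) y : ℂ) = ∑ j, inner ℂ (l j (p j x)) (p j y) := by
      rw [sum_apply, sum_inner]
      refine Finset.sum_congr rfl fun j _ => ?_
      change inner ℂ (p j (l j x)) y = _
      rw [← hidem, hadj, hcomm]
    rw [h1]
    calc ‖∑ j, (inner ℂ (l j (p j x)) (p j y) : ℂ)‖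
        ≤ ∑ j, R * (‖p j x‖ * ‖p j y‖) := by
          refine (norm_sum_le _ _).trans (Finset.sum_le_sum fun j _ => ?_)
          refine (norm_inner_le_norm _ _).trans ?_
          rw [← mul_assoc]
          gcongr
          exact (ContinuousLinearMap.le_opNorm _ _).trans (by gcongr; exact hl j)
      _ = R * ∑ j, ‖p j x‖ * ‖p j y‖ := by rw [Finset.mul_sum]
      _ ≤ R * (Real.sqrt (∑ j, ‖p j x‖ ^ 2) * Real.sqrt (∑ j, ‖p j y‖ ^ 2)) := by
          gcongr
          exact Real.sum_mul_le_sqrt_mul_sqrt _ _ _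
      _ = R * ‖x‖ * ‖y‖ := by
          rw [hsq, hsq, Real.sqrt_sq (norm_nonneg _), Real.sqrt_sq (norm_nonneg _), mul_assoc]
  refine ContinuousLinearMap.opNorm_le_bound _ hR fun x => ?_
  set z := (∑ j, p j * l j) x with hz
  have h := hform x z
  rw [← hz, inner_self_eq_norm_sq_to_K] at h
  have h' : ‖z‖ * ‖z‖ ≤ R * ‖x‖ * ‖z‖ := by simpa [sq] using h
  rcases (norm_nonneg z).eq_or_lt with h0 | h0
  · rw [← h0]
    positivity
  · exact le_of_mul_le_mul_right h' h0

/-- In finite dimensions the hypoconvex hull of a nonempty compact set is indeed the smallest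
hypoconvex set that contains it. -/
theorem isLeast_hypoconvexHull [FiniteDimensional ℂ H] {Q : Set (H →L[ℂ] H)} (hne : Q.Nonempty)
    (hQ : IsCompact Q) : IsLeast {R | IsHypoconvex R ∧ Q ⊆ R} (hypoconvexHull Q) := by
  have : ProperSpace (H →L[ℂ] H) := FiniteDimensional.proper ℂ _
  obtain ⟨q, hq⟩ := hne
  obtain ⟨R, hR⟩ := hQ.isBounded.subset_closedBall (0 : H →L[ℂ] H)
  have hR0 : 0 ≤ R := dist_nonneg.trans (hR hq)
  have hball : IsHypoconvex (Metric.closedBall (0 : H →L[ℂ] H) R) :=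
    { nonempty := ⟨q, hR hq⟩
      isCompact := isCompact_closedBall _ _
      star_mul_mul_mem := fun u hu l hl => by
        rw [mem_closedBall_zero_iff] at hl ⊢
        rwa [CStarRing.norm_mul_mem_unitary _ hu,
          CStarRing.norm_mem_unitary_mul _ (Unitary.star_mem hu)]
      sum_mem := fun m l p hl hp hs hc => by
        rw [mem_closedBall_zero_iff]
        exact norm_sum_le_of_isStarProjection hR0
          (fun j => mem_closedBall_zero_iff.1 (hl j)) hp hs hc }
  have hsub : Q ⊆ hypoconvexHull Q := Set.subset_sInter fun S hS => hS.2
  refine ⟨⟨?_, hsub⟩, fun S hS => Set.sInter_subset_of_mem hS⟩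
  exact
    { nonempty := ⟨q, hsub hq⟩
      isCompact := hball.isCompact.of_isClosed_subset
        (isClosed_sInter fun S hS => hS.1.isCompact.isClosed)
        (Set.sInter_subset_of_mem ⟨hball, hR⟩)
      star_mul_mul_mem := fun u hu l hl => Set.mem_sInter.2 fun S hS =>
        hS.1.star_mul_mul_mem u hu l (Set.mem_sInter.1 hl S hS)
      sum_mem := fun m l p hl hp hs hc => Set.mem_sInter.2 fun S hS =>
        hS.1.sum_mem m l p (fun j => Set.mem_sInter.1 (hl j) S hS) hp hs hc }

end Hypoconvex

/-! ### Star homomorphisms into `B(H)`: invariant subspaces and intertwiners -/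

section Representations

variable {H : Type*} [NormedAddCommGroup H] [InnerProductSpace ℂ H] [CompleteSpace H]

/-! A unitary `v` identifies `M_d(ℂ)` with `B(H)`, so everything reduces to `homSpectrum_Lp`: the
values `ρ(ψ)` of ⋆-homomorphisms into `B(H)` fill out the hypoconvex hull of the essential range
`K`. As `K` is compact and contains almost every value of `ψ`, composition with `ψ` embeds `C(K,
B(H))` into the algebra of essentially bounded functions and sends the inclusion `f : K → B(H)` to
`ψ`. Such values are unchanged by an injective ⋆-homomorphism, so `f` may replace `ψ`.

The values `ρ(f)` form a hypoconvex set containing `K`: evaluations give the points of `K`,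
conjugation gives unitary invariance, commuting projections that sum to `1` glue homomorphisms
together, and Tychonoff's theorem gives compactness. Hence the hull is contained in it.

Conversely, let `S` be hypoconvex with `K ⊆ S`, let `π` be a representation on `H`, and let `ξ` be a
nonzero vector of an irreducible subspace `W`. Some evaluation at a point `k` and some unit vector
`η` satisfy `b(k)η = 0` whenever `π(b)ξ = 0` (`exists_eval_apply_eq_zero`); otherwise compactness of
`K` times the unit sphere would give an invertible `c = ∑ b⋆b` with `π(c)ξ = 0`. So `π(b)ξ ↦ b(k)η`
is a well-defined intertwiner on `W`, by Schur's lemma a multiple of an isometry, and it extends to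
a unitary `u`. Thus `π(f)` agrees on `W` with `u⋆f(k)u ∈ S`. Splitting `H` into irreducible
subspaces writes `π(f)` as a hypoconvex combination of elements of `S`. -/

theorem LinearMap.exists_comp_eq_of_ker_le_ker {K U V W : Type*} [Field K] [AddCommGroup U]
    [Module K U] [AddCommGroup V] [Module K V] [AddCommGroup W] [Module K W]
    (f : U →ₗ[K] V) (g : U →ₗ[K] W) (h : LinearMap.ker f ≤ LinearMap.ker g) :
    ∃ t : V →ₗ[K] W, ∀ x, t (f x) = g x := by
  obtain ⟨s, hs⟩ := f.rangeRestrict.exists_rightInverse_of_surjective f.range_rangeRestrict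
  obtain ⟨t, ht⟩ := LinearMap.exists_extend (g.comp s)
  refine ⟨t, fun x => ?_⟩
  have h1 : t (f x) = g (s (f.rangeRestrict x)) := LinearMap.congr_fun ht (f.rangeRestrict x)
  have h2 : f (s (f.rangeRestrict x)) = f x :=
    congrArg Subtype.val (LinearMap.congr_fun hs (f.rangeRestrict x))
  have h3 : s (f.rangeRestrict x) - x ∈ LinearMap.ker g := h (by
    rw [LinearMap.mem_ker, map_sub, h2, sub_self])
  rw [h1, ← sub_eq_zero, ← map_sub]
  exact h3

/-- The orthogonal projection onto a subspace commutes with every operator which, together with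
its adjoint, leaves the subspace invariant. -/
theorem Submodule.starProjection_mul_comm_of_invariant {W : Submodule ℂ H}
    [W.HasOrthogonalProjection] {a : H →L[ℂ] H} (h : ∀ w ∈ W, a w ∈ W)
    (h' : ∀ w ∈ W, star a w ∈ W) : W.starProjection * a = a * W.starProjection := by
  have hs : star W.starProjection = W.starProjection :=
    (isStarProjection_starProjection (U := W)).isSelfAdjoint.star_eq
  have key : ∀ b : H →L[ℂ] H, (∀ w ∈ W, b w ∈ W) →
      W.starProjection * b * W.starProjection = b * W.starProjection := fun b hb => by
    ext x
    exact Submodule.starProjection_eq_self_iff.2 (hb _ (Submodule.starProjection_apply_mem W x))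
  -- With `P` the projection, invariance under `star a` gives `P a P = P a` after taking adjoints;
  -- invariance under `a` gives `P a P = a P`.
  have h2 := congrArg star (key _ h')
  simp only [star_mul, star_star, hs] at h2
  rw [← key a h, mul_assoc, ← h2]

/-- A subspace is invariant under a family of operators. -/
def IsInvariantUnder {ι : Type*} (π : ι → H →L[ℂ] H) (W : Submodule ℂ H) : Prop :=
  ∀ b, ∀ w ∈ W, π b w ∈ W

variable {B : Type*} [Ring B] [StarRing B] [Algebra ℂ B]

theorem IsInvariantUnder.starProjection_mul_comm {π : B →⋆ₐ[ℂ] (H →L[ℂ] H)} {W : Submodule ℂ H}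
    [W.HasOrthogonalProjection] (hW : IsInvariantUnder π W) (b : B) :
    W.starProjection * π b = π b * W.starProjection :=
  Submodule.starProjection_mul_comm_of_invariant (hW b) (by rw [← map_star]; exact hW (star b))

theorem IsInvariantUnder.orthogonal {π : B →⋆ₐ[ℂ] (H →L[ℂ] H)} {W : Submodule ℂ H}
    (hW : IsInvariantUnder π W) : IsInvariantUnder π Wᗮ := fun b w hw => by
  rw [Submodule.mem_orthogonal] at hw ⊢
  intro u hu
  rw [← ContinuousLinearMap.adjoint_inner_left, ← ContinuousLinearMap.star_eq_adjoint, ← map_star]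
  exact hw _ (hW _ u hu)

/-- A nonzero intertwiner from an irreducible finite dimensional subspace, normalised at one unit
vector, is isometric on this subspace. -/
theorem norm_intertwiner_eq [FiniteDimensional ℂ H] {π σ : B →⋆ₐ[ℂ] (H →L[ℂ] H)}
    {W : Submodule ℂ H} (hW : IsInvariantUnder π W)
    (hmin : ∀ V ≤ W, IsInvariantUnder π V → V ≠ ⊥ → V = W) {ξ : H} (hξW : ξ ∈ W) (hξ : ‖ξ‖ = 1)
    {t : H →L[ℂ] H} (ht : ∀ b, ∀ w ∈ W, t (π b w) = σ b (t w)) (htξ : ‖t ξ‖ = 1) {w : H}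
    (hw : w ∈ W) : ‖t w‖ = ‖w‖ := by
  set P := W.starProjection with hP
  have hPw : ∀ w ∈ W, P w = w := fun w hw => Submodule.starProjection_eq_self_iff.2 hw
  -- `t` intertwines only on `W`; cutting down by `P` gives an intertwiner on all of `H`, so that
  -- adjoints can be taken and `star s * s` commutes with `π`.
  set s := t * P with hs
  have h1 : ∀ b, s * π b = σ b * s := fun b => by
    rw [hs, mul_assoc, hW.starProjection_mul_comm]
    ext x
    exact ht b _ (Submodule.starProjection_apply_mem W x)
  have h2 : ∀ b, star s * σ b = π b * star s := fun b => by
    have := congrArg star (h1 (star b))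
    simpa only [star_mul, ← map_star, star_star] using this.symm
  have h3 : ∀ b, (star s * s) * π b = π b * (star s * s) := fun b => by
    rw [mul_assoc, h1, ← mul_assoc, h2, mul_assoc]
  have hsW : ∀ x, star s x ∈ W := fun x => by
    have : star s = P * star t := by
      rw [hs, star_mul, (isStarProjection_starProjection (U := W)).isSelfAdjoint.star_eq]
    rw [this]
    exact Submodule.starProjection_apply_mem W _
  have hinner : ∀ w ∈ W, inner ℂ w ((star s * s) w) = ((‖t w‖ ^ 2 : ℝ) : ℂ) := fun w hw => by
    have : s w = t w := congrArg t (hPw w hw)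
    change inner ℂ w (star s (s w)) = _
    rw [ContinuousLinearMap.star_eq_adjoint, ContinuousLinearMap.adjoint_inner_right, this,
      inner_self_eq_norm_sq_to_K]
    push_cast
    rfl
  have hWnt : Nontrivial W := ⟨⟨⟨ξ, hξW⟩, 0, fun h => by
    have : ξ = 0 := congrArg Subtype.val h
    simp [this] at hξ⟩⟩
  let A : Module.End ℂ W :=
    ((star s * s : H →L[ℂ] H) : H →ₗ[ℂ] H).restrict (fun w _ => hsW (s w))
  obtain ⟨c, hc⟩ := Module.End.exists_eigenvalue A
  obtain ⟨e, he⟩ := hc.exists_hasEigenvector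
  -- Schur's lemma: this eigenspace of `star s * s` is invariant and nonzero, hence all of `W`. The
  -- eigenvalue is then read off at `ξ`.
  let V : Submodule ℂ H := W ⊓ LinearMap.ker
    ((star s * s - c • 1 : H →L[ℂ] H) : H →ₗ[ℂ] H)
  have hVmem : ∀ x, x ∈ V ↔ x ∈ W ∧ (star s * s) x = c • x := fun x => by
    simp only [V, Submodule.mem_inf, LinearMap.mem_ker]
    refine and_congr_right fun _ => ?_
    change (star s * s) x - c • x = 0 ↔ _
    rw [sub_eq_zero]
  have hV : V = W := by
    refine hmin V inf_le_left (fun b x hx => ?_) ?_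
    · rw [hVmem] at hx ⊢
      refine ⟨hW b x hx.1, ?_⟩
      have := congrArg (fun q : H →L[ℂ] H => q x) (h3 b)
      change (star s * s) (π b x) = π b ((star s * s) x) at this
      rw [this, hx.2, map_smul]
    · refine (Submodule.ne_bot_iff _).2 ⟨e, (hVmem _).2 ⟨e.2, ?_⟩, fun h => he.2 (Subtype.ext h)⟩
      exact congrArg Subtype.val he.apply_eq_smul
  have hsq : ∀ w ∈ W, ((‖t w‖ ^ 2 : ℝ) : ℂ) = c * ((‖w‖ ^ 2 : ℝ) : ℂ) := fun w hw => by
    have hwV : w ∈ V := hV ▸ hw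
    rw [← hinner w hw, ((hVmem w).1 hwV).2, inner_smul_right, inner_self_eq_norm_sq_to_K]
    push_cast
    rfl
  have hc1 : c = 1 := by
    have := hsq ξ hξW
    rw [htξ, hξ] at this
    simpa using this.symm
  have := hsq w hw
  rw [hc1, one_mul] at this
  exact (sq_eq_sq₀ (norm_nonneg _) (norm_nonneg _)).1 (by exact_mod_cast this)

/-- A linear isometry of a finite dimensional space into itself is unitary. -/
theorem exists_unitary_eq_linearIsometry [FiniteDimensional ℂ H] {W : Submodule ℂ H}
    (j : W →ₗᵢ[ℂ] H) : ∃ u ∈ unitary (H →L[ℂ] H), ∀ w : W, u w = j w := by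
  let e : H ≃ₗᵢ[ℂ] H := j.extend.toLinearIsometryEquiv rfl
  refine ⟨(Unitary.linearIsometryEquiv.symm e : unitary (H →L[ℂ] H)), Subtype.property _,
    fun w => ?_⟩
  exact j.extend_apply w

/-- If the vector functional of `π` at a unit vector `ξ` of an irreducible subspace `W` dominates
one of `σ` in the sense of annihilators, then `π` on `W` is unitarily equivalent to a
subrepresentation of `σ`. -/
theorem exists_unitary_intertwiner [FiniteDimensional ℂ H] {π σ : B →⋆ₐ[ℂ] (H →L[ℂ] H)}
    {W : Submodule ℂ H} (hW : IsInvariantUnder π W)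
    (hmin : ∀ V ≤ W, IsInvariantUnder π V → V ≠ ⊥ → V = W) {ξ η : H} (hξW : ξ ∈ W)
    (hξ : ‖ξ‖ = 1) (hη : ‖η‖ = 1) (h : ∀ b, π b ξ = 0 → σ b η = 0) :
    ∃ u ∈ unitary (H →L[ℂ] H), ∀ b, ∀ w ∈ W, (star u * σ b * u) w = π b w := by
  let f (ρ : B →⋆ₐ[ℂ] (H →L[ℂ] H)) (x : H) : B →ₗ[ℂ] H :=
    { toFun := fun b => ρ b x
      map_add' := fun a b => by rw [map_add]; rfl
      map_smul' := fun c b => by rw [map_smul]; rfl }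
  -- The map `π b ξ ↦ σ b η` is well defined by `h`. By irreducibility its domain, the cyclic
  -- subspace of `ξ`, is all of `W`.
  obtain ⟨t, ht⟩ := LinearMap.exists_comp_eq_of_ker_le_ker (f π ξ) (f σ η) h
  have ht' : ∀ b, t (π b ξ) = σ b η := ht
  have hrange : LinearMap.range (f π ξ) = W := by
    refine hmin _ ?_ ?_ ?_
    · rintro _ ⟨b, rfl⟩
      exact hW b ξ hξW
    · rintro b _ ⟨a, rfl⟩
      refine ⟨b * a, ?_⟩
      change π (b * a) ξ = π b (π a ξ)
      rw [map_mul]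
      rfl
    · refine (Submodule.ne_bot_iff _).2 ⟨ξ, ⟨1, ?_⟩, fun h0 => by simp [h0] at hξ⟩
      change π 1 ξ = ξ
      rw [map_one]
      rfl
  have htξ : t ξ = η := by
    have := ht' 1
    rwa [map_one, map_one] at this
  let T : H →L[ℂ] H := LinearMap.toContinuousLinearMap t
  have hT : ∀ b, ∀ w ∈ W, T (π b w) = σ b (T w) := fun b w hw => by
    rw [← hrange] at hw
    obtain ⟨a, rfl⟩ := hw
    change t (π b (π a ξ)) = σ b (t (π a ξ))
    have h1 : π b (π a ξ) = π (b * a) ξ := by rw [map_mul]; rfl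
    rw [h1, ht', ht', map_mul]
    rfl
  let j : W →ₗᵢ[ℂ] H :=
    { toLinearMap := t.comp W.subtype
      norm_map' := fun w => norm_intertwiner_eq hW hmin hξW hξ hT
        (by change ‖t ξ‖ = 1; rw [htξ, hη]) w.2 }
  obtain ⟨u, hu, huj⟩ := exists_unitary_eq_linearIsometry j
  have huT : ∀ w ∈ W, u w = T w := fun w hw => huj ⟨w, hw⟩
  refine ⟨u, hu, fun b w hw => ?_⟩
  change star u (σ b (u w)) = _
  rw [huT w hw, ← hT b w hw, ← huT _ (hW b w hw)]
  exact congrArg (fun q : H →L[ℂ] H => q (π b w)) (Unitary.star_mul_self_of_mem hu)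

end Representations

/-- Every nonzero invariant subspace of a finite dimensional space contains an irreducible one. -/
theorem IsInvariantUnder.exists_minimal {H : Type*} [NormedAddCommGroup H]
    [InnerProductSpace ℂ H] [FiniteDimensional ℂ H] {ι : Type*} {π : ι → H →L[ℂ] H}
    {V : Submodule ℂ H} (hV : IsInvariantUnder π V) (hne : V ≠ ⊥) :
    ∃ W ≤ V, IsInvariantUnder π W ∧ W ≠ ⊥ ∧
      ∀ V' ≤ W, IsInvariantUnder π V' → V' ≠ ⊥ → V' = W := by
  obtain ⟨W, hWV, hW⟩ := exists_minimal_le_of_wellFoundedLT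
    (fun W : Submodule ℂ H => IsInvariantUnder π W ∧ W ≠ ⊥) V ⟨hV, hne⟩
  exact ⟨W, hWV, hW.prop.1, hW.prop.2, fun V' h1 h2 h3 => hW.eq_of_le ⟨h2, h3⟩ h1⟩

/-! ### Values of the star homomorphisms of a singly generated C⋆-algebra -/

section HomSpectrum

variable {A : Type*} [CStarAlgebra A] {C : Type*} [CStarAlgebra C]

/-- All `ρ(a)`, where `ρ` runs through the unital ⋆-homomorphisms into `C` from the unital
C⋆-subalgebra generated by `a`. -/
def homSpectrum (C : Type*) [CStarAlgebra C] (a : A) : Set C :=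
  {l | ∃ ρ : StarAlgebra.elemental ℂ a →⋆ₐ[ℂ] C, ρ ⟨a, StarAlgebra.elemental.self_mem ℂ a⟩ = l}

/-- An injective ⋆-homomorphism is isometric, so it carries closed subalgebras to closed ones and
restricts to an isomorphism between the C⋆-algebras generated by `a` and by `i a`. -/
theorem homSpectrum_map_of_injective {A' : Type*} [CStarAlgebra A'] (i : A →⋆ₐ[ℂ] A')
    (hi : Function.Injective i) (a : A) : homSpectrum C (i a) = homSpectrum C a := by
  have hiso : Isometry i := NonUnitalStarAlgHom.isometry i hi
  ext l
  constructor
  · rintro ⟨ρ, rfl⟩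
    have hle : StarAlgebra.elemental ℂ a ≤ (StarAlgebra.elemental ℂ (i a)).comap i :=
      StarAlgebra.elemental.le_of_mem
        ((StarAlgebra.elemental.isClosed ℂ (i a)).preimage hiso.continuous)
        (StarAlgebra.elemental.self_mem ℂ (i a))
    exact ⟨ρ.comp ((i.comp (StarSubalgebra.subtype _)).codRestrict _ fun x => hle x.2), rfl⟩
  · rintro ⟨ρ, rfl⟩
    have hclosed : IsClosed (((StarAlgebra.elemental ℂ a).map i : StarSubalgebra ℂ A') : Set A') :=
      hiso.isClosedEmbedding.isClosedMap _ (StarAlgebra.elemental.isClosed ℂ a)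
    have hle : StarAlgebra.elemental ℂ (i a) ≤ (StarAlgebra.elemental ℂ a).map i :=
      StarAlgebra.elemental.le_of_mem hclosed ⟨a, StarAlgebra.elemental.self_mem ℂ a, rfl⟩
    let j : StarAlgebra.elemental ℂ a →⋆ₐ[ℂ] A' := i.comp (StarSubalgebra.subtype _)
    have hj : Function.Injective j := hi.comp Subtype.val_injective
    have hmem : ∀ x : StarAlgebra.elemental ℂ (i a), (x : A') ∈ j.range := fun x => by
      obtain ⟨y, hy, hyx⟩ := hle x.2
      exact ⟨⟨y, hy⟩, hyx⟩
    let e := StarAlgEquiv.ofInjective j hj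
    refine ⟨ρ.comp ((e.symm : j.range →⋆ₐ[ℂ] _).comp
      ((StarSubalgebra.subtype _).codRestrict _ hmem)), ?_⟩
    change ρ (e.symm _) = _
    congr 1
    rw [StarAlgEquiv.symm_apply_eq]
    rfl

/-- An element commuting with the image of the generator and of its adjoint commutes with the image
of every ⋆-homomorphism. -/
theorem StarAlgebra.elemental.map_commute {a : A} (ρ : StarAlgebra.elemental ℂ a →⋆ₐ[ℂ] C) {p : C}
    (h : Commute p (ρ ⟨a, StarAlgebra.elemental.self_mem ℂ a⟩))
    (h' : Commute p (star (ρ ⟨a, StarAlgebra.elemental.self_mem ℂ a⟩)))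
    (b : StarAlgebra.elemental ℂ a) : Commute p (ρ b) := by
  have hρ : Continuous ρ := AddMonoidHomClass.continuous_of_bound ρ 1 fun x => by
    rw [one_mul]
    exact NonUnitalStarAlgHom.norm_apply_le ρ x
  obtain ⟨b, hb⟩ := b
  induction hb using StarAlgebra.elemental.induction_on with
  | self => exact h
  | star_self => rw [← map_star] at h'; exact h'
  | algebraMap r =>
    have : ρ (algebraMap ℂ _ r) = algebraMap ℂ C r := AlgHomClass.commutes ρ r
    change Commute p (ρ (algebraMap ℂ _ r))
    rw [this]
    exact (Algebra.commutes r p).symm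
  | add u hu v hv h1 h2 =>
    change Commute p (ρ (⟨u, hu⟩ + ⟨v, hv⟩))
    rw [map_add]
    exact h1.add_right h2
  | mul u hu v hv h1 h2 =>
    change Commute p (ρ (⟨u, hu⟩ * ⟨v, hv⟩))
    rw [map_mul]
    exact h1.mul_right h2
  | closure s hs hP v hv =>
    have hcl : IsClosed {x : StarAlgebra.elemental ℂ a | p * ρ x = ρ x * p} :=
      isClosed_eq (by fun_prop) (by fun_prop)
    have hsub : ((↑) ⁻¹' s : Set (StarAlgebra.elemental ℂ a)) ⊆ {x | p * ρ x = ρ x * p} :=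
      fun x hx => hP x hx
    refine closure_minimal hsub hcl ?_
    have himage : Subtype.val '' ((↑) ⁻¹' s : Set (StarAlgebra.elemental ℂ a)) = s :=
      Set.Subset.antisymm (Set.image_preimage_subset _ _) fun x hx => ⟨⟨x, hs hx⟩, hx, rfl⟩
    exact closure_subtype.2 (himage.symm ▸ hv)

/-- Compressing `∑ p k = 1` by `p j` leaves `∑ (p k p j)⋆ (p k p j) = 0` over `k ≠ j`; a vanishing
sum of positive elements has vanishing terms. -/
theorem IsStarProjection.mul_eq_zero_of_sum_eq_one {m : ℕ} {p : Fin m → C}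
    (hp : ∀ j, IsStarProjection (p j)) (hs : ∑ j, p j = 1) {i j : Fin m} (hij : i ≠ j) :
    p i * p j = 0 := by
  let := CStarAlgebra.spectralOrder C
  have := CStarAlgebra.spectralOrderedRing C
  have h1 : ∑ k ∈ Finset.univ.erase j, star (p k * p j) * (p k * p j) = 0 := by
    have h2 : ∀ k, star (p k * p j) * (p k * p j) = p j * p k * p j := fun k => by
      rw [star_mul, (hp k).isSelfAdjoint.star_eq, (hp j).isSelfAdjoint.star_eq, mul_assoc,
        ← mul_assoc (p k), (hp k).isIdempotentElem.eq, mul_assoc]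
    have h3 : ∑ k, p j * p k * p j = p j := by
      rw [← Finset.sum_mul, ← Finset.mul_sum, hs, mul_one, (hp j).isIdempotentElem.eq]
    rw [← Finset.add_sum_erase _ _ (Finset.mem_univ j), (hp j).isIdempotentElem.eq,
      (hp j).isIdempotentElem.eq] at h3
    simp only [h2]
    exact add_eq_left.1 h3
  have h4 := (Finset.sum_eq_zero_iff_of_nonneg fun k _ => star_mul_self_nonneg (p k * p j)).1 h1 i
    (Finset.mem_erase.2 ⟨hij, Finset.mem_univ i⟩)
  exact CStarRing.star_mul_self_eq_zero_iff _ |>.1 h4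

/-- The witness is `b ↦ ∑ p j * ρ j b`. It is multiplicative because the `p j` are mutually
orthogonal and each commutes with the whole image of `ρ j`, not only with `l j`. -/
theorem sum_mem_homSpectrum {a : A} {m : ℕ} {l p : Fin m → C} (hl : ∀ j, l j ∈ homSpectrum C a)
    (hp : ∀ j, IsStarProjection (p j)) (hs : ∑ j, p j = 1) (hc : ∀ j, p j * l j = l j * p j) :
    ∑ j, p j * l j ∈ homSpectrum C a := by
  choose ρ hρ using hl
  have hcomm : ∀ j b, p j * ρ j b = ρ j b * p j := fun j =>
    StarAlgebra.elemental.map_commute (ρ j) (by rw [hρ]; exact hc j) (by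
      rw [hρ]
      have := congrArg star (hc j)
      rw [star_mul, star_mul, (hp j).isSelfAdjoint.star_eq] at this
      exact this.symm)
  have horth := fun i j => IsStarProjection.mul_eq_zero_of_sum_eq_one hp hs (i := i) (j := j)
  have hmul : ∀ b c, ∑ j, p j * ρ j (b * c) = (∑ j, p j * ρ j b) * ∑ j, p j * ρ j c := by
    intro b c
    rw [Finset.sum_mul_sum]
    refine Finset.sum_congr rfl fun j _ => ?_
    rw [Finset.sum_eq_single j]
    · rw [map_mul, hcomm j b, mul_assoc (ρ j b), ← mul_assoc (p j) (p j),
        (hp j).isIdempotentElem.eq, ← mul_assoc, ← mul_assoc, hcomm j b]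
    · intro k _ hk
      rw [hcomm j b, mul_assoc, ← mul_assoc (p j), horth j k hk.symm, zero_mul, mul_zero]
    · exact fun h => (h (Finset.mem_univ j)).elim
  let f : StarAlgebra.elemental ℂ a →ₗ[ℂ] C :=
    { toFun := fun b => ∑ j, p j * ρ j b
      map_add' := fun b c => by simp only [map_add, mul_add, Finset.sum_add_distrib]
      map_smul' := fun r b => by
        simp only [map_smul, mul_smul_comm, Finset.smul_sum, RingHom.id_apply] }
  let σ : StarAlgebra.elemental ℂ a →⋆ₐ[ℂ] C :=
    { AlgHom.ofLinearMap f (by change ∑ j, p j * ρ j 1 = 1; simp only [map_one, mul_one, hs])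
        hmul with
      map_star' := fun b => by
        change ∑ j, p j * ρ j (star b) = star (∑ j, p j * ρ j b)
        rw [star_sum]
        refine Finset.sum_congr rfl fun j _ => ?_
        rw [hcomm, map_star, star_mul, (hp j).isSelfAdjoint.star_eq] }
  refine ⟨σ, ?_⟩
  change ∑ j, p j * ρ j _ = _
  simp only [hρ]

/-- ⋆-homomorphisms are contractive, so they form a pointwise closed subset of a product of compact
balls; evaluation at `a` is continuous on it. -/
theorem isCompact_homSpectrum [ProperSpace C] (a : A) : IsCompact (homSpectrum C a) := by
  let S : Set (StarAlgebra.elemental ℂ a → C) :=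
    {f | ∃ ρ : StarAlgebra.elemental ℂ a →⋆ₐ[ℂ] C, ⇑ρ = f}
  have hS : S = {f | f 1 = 1 ∧ (∀ b c, f (b * c) = f b * f c) ∧ (∀ b c, f (b + c) = f b + f c) ∧
      (∀ (r : ℂ) b, f (r • b) = r • f b) ∧ ∀ b, f (star b) = star (f b)} := by
    ext f
    constructor
    · rintro ⟨ρ, rfl⟩
      exact ⟨map_one ρ, map_mul ρ, map_add ρ, map_smul ρ, map_star ρ⟩
    · rintro ⟨h1, h2, h3, h4, h5⟩
      let g : StarAlgebra.elemental ℂ a →ₗ[ℂ] C :=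
        { toFun := f, map_add' := h3, map_smul' := h4 }
      exact ⟨{ AlgHom.ofLinearMap g h1 h2 with map_star' := h5 }, rfl⟩
  have hclosed : IsClosed S := by
    rw [hS]
    simp only [Set.ofPred_and, Set.ofPred_forall]
    refine IsClosed.inter (isClosed_eq (by fun_prop) (by fun_prop)) (IsClosed.inter
      (isClosed_iInter fun b => isClosed_iInter fun c => isClosed_eq (by fun_prop) (by fun_prop))
      (IsClosed.inter
      (isClosed_iInter fun b => isClosed_iInter fun c => isClosed_eq (by fun_prop) (by fun_prop))
      (IsClosed.inter
      (isClosed_iInter fun r => isClosed_iInter fun b => isClosed_eq (by fun_prop) (by fun_prop))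
      (isClosed_iInter fun b => isClosed_eq (by fun_prop) (by fun_prop)))))
  have hcompact : IsCompact S := by
    refine (isCompact_univ_pi fun b : StarAlgebra.elemental ℂ a =>
      isCompact_closedBall (0 : C) ‖b‖).of_isClosed_subset hclosed ?_
    rintro _ ⟨ρ, rfl⟩ b -
    rw [mem_closedBall_zero_iff]
    exact NonUnitalStarAlgHom.norm_apply_le ρ b
  have himage : homSpectrum C a = (fun f : StarAlgebra.elemental ℂ a → C =>
      f ⟨a, StarAlgebra.elemental.self_mem ℂ a⟩) '' S := by
    ext l
    constructor
    · rintro ⟨ρ, rfl⟩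
      exact ⟨ρ, ⟨ρ, rfl⟩, rfl⟩
    · rintro ⟨_, ⟨ρ, rfl⟩, rfl⟩
      exact ⟨ρ, rfl⟩
  rw [himage]
  exact hcompact.image (continuous_apply _)

theorem comp_starAlgHom_mem_homSpectrum {D : Type*} [CStarAlgebra D] (φ : C →⋆ₐ[ℂ] D) {a : A}
    {l : C} (hl : l ∈ homSpectrum C a) : φ l ∈ homSpectrum D a := by
  obtain ⟨ρ, rfl⟩ := hl
  exact ⟨φ.comp ρ, rfl⟩

end HomSpectrum

theorem isHypoconvex_homSpectrum {H : Type*} [NormedAddCommGroup H] [InnerProductSpace ℂ H]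
    [CompleteSpace H] [FiniteDimensional ℂ H] {A : Type*} [CStarAlgebra A] {a : A}
    (hne : (homSpectrum (H →L[ℂ] H) a).Nonempty) : IsHypoconvex (homSpectrum (H →L[ℂ] H) a) where
  nonempty := hne
  isCompact :=
    haveI : ProperSpace (H →L[ℂ] H) := FiniteDimensional.proper ℂ _
    isCompact_homSpectrum a
  star_mul_mul_mem u hu l hl := by
    have := comp_starAlgHom_mem_homSpectrum
      (Unitary.conjStarAlgAut ℂ (H →L[ℂ] H) (star ⟨u, hu⟩) : (H →L[ℂ] H) →⋆ₐ[ℂ] (H →L[ℂ] H)) hl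
    simpa [Unitary.conjStarAlgAut_apply] using this
  sum_mem m l p hl hp hs hc := sum_mem_homSpectrum hl hp hs hc

/-! ### Decomposition into irreducible subspaces -/

theorem Submodule.starProjection_eq_add_of_le {H : Type*} [NormedAddCommGroup H]
    [InnerProductSpace ℂ H] [FiniteDimensional ℂ H] {V W : Submodule ℂ H} (hWV : W ≤ V) :
    V.starProjection = W.starProjection + (V ⊓ Wᗮ).starProjection := by
  ext x
  have h : (V ⊓ Wᗮ).starProjection x = V.starProjection x - W.starProjection x := by
    refine Submodule.eq_starProjection_of_mem_orthogonal ⟨?_, ?_⟩ ?_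
    · exact V.sub_mem (V.starProjection_apply_mem x) (hWV (W.starProjection_apply_mem x))
    · have h1 := Wᗮ.sub_mem (W.sub_starProjection_mem_orthogonal x)
        (Submodule.orthogonal_le hWV (V.sub_starProjection_mem_orthogonal x))
      rwa [sub_sub_sub_cancel_left] at h1
    · rw [sub_sub_eq_add_sub, add_sub_right_comm]
      refine Submodule.add_mem _
        (Submodule.orthogonal_le inf_le_left (V.sub_starProjection_mem_orthogonal x)) ?_
      exact Submodule.orthogonal_le inf_le_right
        (W.le_orthogonal_orthogonal (W.starProjection_apply_mem x))
  rw [_root_.add_apply, h, add_sub_cancel]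

section Decomposition

variable {H : Type*} [NormedAddCommGroup H] [InnerProductSpace ℂ H] [CompleteSpace H]
  [FiniteDimensional ℂ H] {B : Type*} [Ring B] [StarRing B] [Algebra ℂ B]

/-- Let every vector functional of `π` be dominated, in the sense of annihilators, by one of a
representation `σ` with `σ g` in the hypoconvex set `S`. Then `π g` acts on every irreducible
subspace as an element of `S`. -/
theorem exists_mem_hypoconvex_of_irreducible {S : Set (H →L[ℂ] H)} (hS : IsHypoconvex S)
    {π : B →⋆ₐ[ℂ] (H →L[ℂ] H)} {g : B} (hdom : ∀ ξ : H, ξ ≠ 0 →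
      ∃ (σ : B →⋆ₐ[ℂ] (H →L[ℂ] H)) (η : H), σ g ∈ S ∧ ‖η‖ = 1 ∧ ∀ b, π b ξ = 0 → σ b η = 0)
    {W : Submodule ℂ H}
    (hW : IsInvariantUnder π W) (hne : W ≠ ⊥)
    (hmin : ∀ V ≤ W, IsInvariantUnder π V → V ≠ ⊥ → V = W) :
    ∃ l ∈ S, W.starProjection * l = l * W.starProjection ∧ W.starProjection * l =
      π g * W.starProjection := by
  obtain ⟨x, hxW, hx⟩ := (Submodule.ne_bot_iff _).1 hne
  have hxn : ‖x‖ ≠ 0 := norm_ne_zero_iff.2 hx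
  have hξ : ‖((‖x‖⁻¹ : ℝ) : ℂ) • x‖ = 1 := by
    rw [norm_smul, Complex.norm_real, norm_inv, norm_norm, inv_mul_cancel₀ hxn]
  obtain ⟨σ, η, hg, hη, h⟩ := hdom (((‖x‖⁻¹ : ℝ) : ℂ) • x)
    (norm_ne_zero_iff.1 (hξ.symm ▸ one_ne_zero))
  obtain ⟨u, hu, hu'⟩ := exists_unitary_intertwiner hW hmin (W.smul_mem _ hxW) hξ hη h
  have hl : star u * σ g * u ∈ S := hS.star_mul_mul_mem u hu _ hg
  have hstar : star (star u * σ g * u) =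
      star u * σ (star g) * u := by
    rw [star_mul, star_mul, star_star, ← map_star, mul_assoc]
  have hcomm := Submodule.starProjection_mul_comm_of_invariant (W := W)
    (fun w hw => by rw [hu' g w hw]; exact hW g w hw)
    (fun w hw => by rw [hstar, hu' (star g) w hw]; exact hW (star g) w hw)
  refine ⟨_, hl, hcomm, ?_⟩
  rw [hcomm]
  ext y
  exact hu' g _ (Submodule.starProjection_apply_mem W y)

/-- An invariant subspace is an orthogonal sum of irreducible ones, so that `π g`
acts on it as a hypoconvex combination of elements of `S`. -/
theorem exists_decomposition_of_invariant {S : Set (H →L[ℂ] H)} (hS : IsHypoconvex S)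
    {π : B →⋆ₐ[ℂ] (H →L[ℂ] H)} {g : B} (hdom : ∀ ξ : H, ξ ≠ 0 →
      ∃ (σ : B →⋆ₐ[ℂ] (H →L[ℂ] H)) (η : H), σ g ∈ S ∧ ‖η‖ = 1 ∧ ∀ b, π b ξ = 0 → σ b η = 0)
    (V : Submodule ℂ H)
    (hV : IsInvariantUnder π V) :
    ∃ (m : ℕ) (l p : Fin m → (H →L[ℂ] H)), (∀ j, l j ∈ S) ∧ (∀ j, IsStarProjection (p j)) ∧
      ∑ j, p j = V.starProjection ∧ (∀ j, p j * l j = l j * p j) ∧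
      ∑ j, p j * l j = π g * V.starProjection := by
  induction V using WellFoundedLT.induction with
  | ind V ih =>
  by_cases hV0 : V = ⊥
  · subst hV0
    exact ⟨0, Fin.elim0, Fin.elim0, fun j => j.elim0, fun j => j.elim0, by simp,
      fun j => j.elim0, by simp⟩
  obtain ⟨W, hWV, hW, hW0, hmin⟩ := hV.exists_minimal hV0
  obtain ⟨l₀, hl₀, hc₀, hp₀⟩ := exists_mem_hypoconvex_of_irreducible hS hdom hW hW0 hmin
  -- Equality would put `W` inside its own orthogonal complement.
  have hlt : V ⊓ Wᗮ < V := by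
    refine inf_le_left.lt_of_ne fun h => hW0 ?_
    have h1 : W ≤ Wᗮ := hWV.trans (inf_eq_left.1 h)
    exact Submodule.isOrtho_self.1 h1
  have hadd := Submodule.starProjection_eq_add_of_le hWV
  obtain ⟨m, l, p, hl, hp, hs, hc, hsum⟩ := ih (V ⊓ Wᗮ) hlt
    fun b w hw => ⟨hV b w hw.1, hW.orthogonal b w hw.2⟩
  refine ⟨m + 1, Fin.cons l₀ l, Fin.cons W.starProjection p, ?_, ?_, ?_, ?_, ?_⟩
  · exact Fin.cases hl₀ hl
  · exact Fin.cases isStarProjection_starProjection hp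
  · rw [Fin.sum_univ_succ]
    simp only [Fin.cons_zero, Fin.cons_succ]
    rw [hs, hadd]
  · exact Fin.cases hc₀ hc
  · rw [Fin.sum_univ_succ]
    simp only [Fin.cons_zero, Fin.cons_succ]
    rw [hsum, hadd, mul_add, hp₀]

theorem map_mem_of_isHypoconvex {A : Type*} [CStarAlgebra A] {a : A} {S : Set (H →L[ℂ] H)}
    (hS : IsHypoconvex S) (π : StarAlgebra.elemental ℂ a →⋆ₐ[ℂ] (H →L[ℂ] H))
    (hdom : ∀ ξ : H, ξ ≠ 0 → ∃ (σ : StarAlgebra.elemental ℂ a →⋆ₐ[ℂ] (H →L[ℂ] H)) (η : H),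
      σ ⟨a, StarAlgebra.elemental.self_mem ℂ a⟩ ∈ S ∧ ‖η‖ = 1 ∧ ∀ b, π b ξ = 0 → σ b η = 0) :
    π ⟨a, StarAlgebra.elemental.self_mem ℂ a⟩ ∈ S := by
  obtain ⟨m, l, p, hl, hp, hs, hc, hsum⟩ := exists_decomposition_of_invariant hS hdom ⊤
    fun _ _ _ => Submodule.mem_top
  rw [Submodule.starProjection_top'] at hs hsum
  rw [mul_one] at hsum
  rw [← hsum]
  exact hS.sum_mem m l p hl hp hs hc

end Decomposition

/-! ### Continuous operator valued functions on a compact space -/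

section ContinuousFunctions

variable {H : Type*} [NormedAddCommGroup H] [InnerProductSpace ℂ H] [CompleteSpace H]
  [FiniteDimensional ℂ H] {K : Type*} [TopologicalSpace K] [CompactSpace K]

/-- Evaluation at a point, restricted to a star subalgebra of `C(K, B(H))`. -/
noncomputable def evalOnStarSubalgebra (B : StarSubalgebra ℂ C(K, H →L[ℂ] H)) (k : K) :
    B →⋆ₐ[ℂ] (H →L[ℂ] H) where
  toFun b := (b : C(K, H →L[ℂ] H)) k
  map_one' := rfl
  map_mul' _ _ := rfl
  map_zero' := rfl
  map_add' _ _ := rfl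
  commutes' _ := rfl
  map_star' _ := rfl

theorem ContinuousLinearMap.isUnit_of_forall_apply_ne_zero {a : H →L[ℂ] H}
    (h : ∀ x, x ≠ 0 → a x ≠ 0) : IsUnit a := by
  have hinj : Function.Injective (a : H →ₗ[ℂ] H) := by
    refine (injective_iff_map_eq_zero _).2 fun x hx => ?_
    by_contra hx0
    exact h x hx0 hx
  rw [ContinuousLinearMap.isUnit_iff_bijective]
  exact ⟨hinj, LinearMap.injective_iff_surjective.1 hinj⟩

/-- The left kernel of a vector functional of a representation of a C⋆-algebra of continuous
operator valued functions is contained in the left kernel of a vector functional of an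
evaluation. -/
theorem exists_eval_apply_eq_zero {B : StarSubalgebra ℂ C(K, H →L[ℂ] H)}
    [hB : IsClosed (B : Set C(K, H →L[ℂ] H))] (π : B →⋆ₐ[ℂ] (H →L[ℂ] H)) {ξ : H} (hξ : ξ ≠ 0) :
    ∃ k, ∃ η : H, ‖η‖ = 1 ∧ ∀ b, π b ξ = 0 → evalOnStarSubalgebra B k b η = 0 := by
  by_contra hcon
  have : ProperSpace H := FiniteDimensional.proper ℂ H
  have hex : ∀ x : K × Metric.sphere (0 : H) 1, ∃ b : B, π b ξ = 0 ∧
      (b : C(K, H →L[ℂ] H)) x.1 x.2 ≠ 0 := fun x => by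
    by_contra hx
    push Not at hx
    exact hcon ⟨x.1, x.2, mem_sphere_zero_iff_norm.1 x.2.2, hx⟩
  choose b hb hbne using hex
  have hcont : ∀ x, Continuous fun y : K × Metric.sphere (0 : H) 1 =>
      (b x : C(K, H →L[ℂ] H)) y.1 (y.2 : H) := fun x => by fun_prop
  obtain ⟨s, hs⟩ := isCompact_univ.elim_finite_subcover
    (fun x => {y : K × Metric.sphere (0 : H) 1 | (b x : C(K, H →L[ℂ] H)) y.1 (y.2 : H) ≠ 0})
    (fun x => isOpen_ne_fun (hcont x) continuous_const)
    (fun x _ => Set.mem_iUnion.2 ⟨x, hbne x⟩)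
  -- `c` annihilates `ξ` under `π`, yet `⟨v, c(k)v⟩ = ∑ ‖b x (k) v‖²` is positive for every `k` and
  -- every `v ≠ 0`, by the choice of the finite subcover.
  let c : B := ∑ x ∈ s, star (b x) * b x
  have hcξ : π c ξ = 0 := by
    simp only [c, map_sum, map_mul, sum_apply]
    refine Finset.sum_eq_zero fun x _ => ?_
    change π (star (b x)) (π (b x) ξ) = 0
    rw [hb, map_zero]
  have hinner : ∀ k v, inner ℂ v (evalOnStarSubalgebra B k c v) =
      ((∑ x ∈ s, ‖(b x : C(K, H →L[ℂ] H)) k v‖ ^ 2 : ℝ) : ℂ) := fun k v => by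
    simp only [c, map_sum, map_mul, map_star, sum_apply, inner_sum, Complex.ofReal_sum]
    refine Finset.sum_congr rfl fun x _ => ?_
    change inner ℂ v (star (evalOnStarSubalgebra B k (b x)) (evalOnStarSubalgebra B k (b x) v)) = _
    rw [ContinuousLinearMap.star_eq_adjoint, ContinuousLinearMap.adjoint_inner_right,
      inner_self_eq_norm_sq_to_K]
    push_cast
    rfl
  have hunit : IsUnit (c : C(K, H →L[ℂ] H)) := by
    rw [ContinuousMap.isUnit_iff_forall_isUnit]
    refine fun k => ContinuousLinearMap.isUnit_of_forall_apply_ne_zero fun v hv hcv => ?_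
    have h0 := hinner k v
    have hcv' : evalOnStarSubalgebra B k c v = 0 := hcv
    rw [hcv', inner_zero_right] at h0
    have h1 : ∑ x ∈ s, ‖(b x : C(K, H →L[ℂ] H)) k v‖ ^ 2 = 0 := by exact_mod_cast h0.symm
    rw [Finset.sum_eq_zero_iff_of_nonneg fun _ _ => by positivity] at h1
    have hvn : ‖v‖ ≠ 0 := norm_ne_zero_iff.2 hv
    let y : K × Metric.sphere (0 : H) 1 := ⟨k, ⟨((‖v‖⁻¹ : ℝ) : ℂ) • v, by
      rw [mem_sphere_zero_iff_norm, norm_smul, Complex.norm_real, norm_inv, norm_norm,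
        inv_mul_cancel₀ hvn]⟩⟩
    obtain ⟨x, hx, hxy⟩ := Set.mem_iUnion₂.1 (hs (Set.mem_univ y))
    refine hxy ?_
    change (b x : C(K, H →L[ℂ] H)) k (((‖v‖⁻¹ : ℝ) : ℂ) • v) = 0
    rw [map_smul, norm_eq_zero.1 (pow_eq_zero_iff two_ne_zero |>.1 (h1 x hx)), smul_zero]
  -- Spectral permanence: the inverse of `c` already lies in the closed subalgebra `B`, where `π` is
  -- defined.
  have hunit' : IsUnit (π c) := ((StarSubalgebra.coe_isUnit B).1 hunit).map π
  rw [ContinuousLinearMap.isUnit_iff_bijective] at hunit'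
  exact hξ (hunit'.1 (by rw [hcξ, map_zero]))


/-- The values of the ⋆-homomorphisms from the C⋆-algebra generated by a continuous operator
valued function form the smallest hypoconvex set containing the values of the function. -/
theorem homSpectrum_continuousMap [Nonempty K] (f : C(K, H →L[ℂ] H)) :
    homSpectrum (H →L[ℂ] H) f = hypoconvexHull (Set.range f) := by
  have hsub : Set.range f ⊆ homSpectrum (H →L[ℂ] H) f := by
    rintro _ ⟨k, rfl⟩
    exact ⟨evalOnStarSubalgebra _ k, rfl⟩
  refine Set.Subset.antisymm ?_ (Set.sInter_subset_of_mem
    ⟨isHypoconvex_homSpectrum ((Set.range_nonempty f).mono hsub), hsub⟩)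
  rintro _ ⟨π, rfl⟩
  have : IsClosed (StarAlgebra.elemental ℂ f : Set C(K, H →L[ℂ] H)) :=
    StarAlgebra.elemental.isClosed ℂ f
  refine Set.mem_sInter.2 fun S ⟨hS, hfS⟩ => ?_
  refine map_mem_of_isHypoconvex hS π fun ξ hξ => ?_
  obtain ⟨k, η, hη, h⟩ := exists_eval_apply_eq_zero π hξ
  exact ⟨evalOnStarSubalgebra _ k, η, hfS ⟨k, rfl⟩, hη, h⟩

end ContinuousFunctions

/-! ### The essential range of an essentially bounded function -/

section EssRange

variable {X : Type*} [MeasurableSpace X] {μ : Measure X}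

/-- Open neighbourhoods suffice on both sides. This makes the closedness and conullness of the
support of a measure available for essential ranges. -/
theorem essRange_eq_support_map {E : Type*} [TopologicalSpace E] [MeasurableSpace E]
    [OpensMeasurableSpace E] {f : X → E} (hf : Measurable f) :
    essRange μ f = (μ.map f).support := by
  ext l
  rw [Measure.mem_support_iff_forall]
  refine ⟨fun h U hU => ?_, fun h U hU => ?_⟩ <;>
    obtain ⟨V, hVU, hV, hlV⟩ := mem_nhds_iff.1 hU <;>
    have hmap := Measure.map_apply (μ := μ) hf hV.measurableSet
  · exact ((h V (hV.mem_nhds hlV)).trans_eq hmap.symm).trans_le (measure_mono hVU)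
  · exact ((h V (hV.mem_nhds hlV)).trans_eq hmap).trans_le (measure_mono (Set.preimage_mono hVU))

variable {A : Type*} [CStarAlgebra A]

theorem isClosed_essRange_Lp (ψ : Lp A ∞ μ) : IsClosed (essRange μ ψ) := by
  borelize A
  rw [essRange_eq_support_map (Lp.stronglyMeasurable ψ).measurable]
  exact Measure.isClosed_support

theorem isCompact_essRange_Lp [ProperSpace A] (ψ : Lp A ∞ μ) : IsCompact (essRange μ ψ) := by
  refine (isCompact_closedBall (0 : A) ‖ψ‖).of_isClosed_subset (isClosed_essRange_Lp ψ)
    fun l hl => ?_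
  by_contra hlb
  refine (hl _ (Metric.isClosed_closedBall.isOpen_compl.mem_nhds hlb)).ne' ?_
  change μ {x | ¬ ψ x ∈ Metric.closedBall 0 ‖ψ‖} = 0
  simp only [mem_closedBall_zero_iff]
  exact ae_iff.1 (LInfty.ae_norm_le ψ)

theorem ae_mem_essRange_Lp [ProperSpace A] (ψ : Lp A ∞ μ) : ∀ᵐ x ∂μ, ψ x ∈ essRange μ ψ := by
  borelize A
  have hψ : Measurable ψ := (Lp.stronglyMeasurable ψ).measurable
  rw [essRange_eq_support_map hψ]
  exact ae_of_ae_map hψ.aemeasurable Measure.support_mem_ae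

theorem nonempty_essRange_Lp [ProperSpace A] (hμ : μ ≠ 0) (ψ : Lp A ∞ μ) :
    (essRange μ ψ).Nonempty := by
  have : (ae μ).NeBot := ae_neBot.2 hμ
  obtain ⟨x, hx⟩ := (ae_mem_essRange_Lp ψ).exists
  exact ⟨_, hx⟩

/-- Continuous functions on the essential range can be composed only with a map landing there
everywhere, so the null set of exceptional points is sent to an arbitrary `k₀` of the essential
range. -/
theorem exists_stronglyMeasurable_essRange [ProperSpace A] (hμ : μ ≠ 0) (ψ : Lp A ∞ μ) :
    ∃ φ : X → essRange μ ψ, StronglyMeasurable φ ∧ (fun x => (φ x : A)) =ᵐ[μ] ψ := by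
  classical
  borelize A
  obtain ⟨k₀, hk₀⟩ := nonempty_essRange_Lp hμ ψ
  have hψ : Measurable ψ := (Lp.stronglyMeasurable ψ).measurable
  let s : Set X := ψ ⁻¹' essRange μ ψ
  have hs : MeasurableSet s := hψ (isClosed_essRange_Lp ψ).measurableSet
  let g : X → A := s.piecewise ψ fun _ => k₀
  have hg : Measurable g := hψ.piecewise hs measurable_const
  have hmem : ∀ x, g x ∈ essRange μ ψ := fun x => by
    change s.piecewise ψ (fun _ => k₀) x ∈ _
    by_cases hx : x ∈ s
    · rw [Set.piecewise_eq_of_mem _ _ _ hx]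
      exact hx
    · rw [Set.piecewise_eq_of_notMem _ _ _ hx]
      exact hk₀
  refine ⟨fun x => ⟨g x, hmem x⟩, (hg.subtype_mk (h := hmem)).stronglyMeasurable, ?_⟩
  filter_upwards [ae_mem_essRange_Lp ψ] with x hx
  exact Set.piecewise_eq_of_mem _ _ _ hx

theorem memLp_top_comp_stronglyMeasurable {K : Type*} [TopologicalSpace K] [CompactSpace K]
    {φ : X → K} (hφ : StronglyMeasurable φ) (c : C(K, A)) : MemLp (fun x => c (φ x)) ∞ μ :=
  memLp_top_of_bound (c.continuous.comp_stronglyMeasurable hφ).aestronglyMeasurable ‖c‖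
    (ae_of_all _ fun x => c.norm_coe_le_norm (φ x))

/-- Composition of continuous functions on a compact space with a strongly measurable function. -/
noncomputable def LInfty.compStarAlgHom (μ : Measure X) {K : Type*} [TopologicalSpace K]
    [CompactSpace K] (φ : X → K) (hφ : StronglyMeasurable φ) : C(K, A) →⋆ₐ[ℂ] Lp A ∞ μ :=
  let hmem := memLp_top_comp_stronglyMeasurable (μ := μ) (A := A) hφ
  let T : C(K, A) →ₗ[ℂ] Lp A ∞ μ :=
    { toFun := fun c => (hmem c).toLp _
      map_add' := fun _ _ => rfl
      map_smul' := fun _ _ => rfl }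
  { AlgHom.ofLinearMap T rfl fun b c => Lp.ext <| by
      filter_upwards [(hmem (b * c)).coeFn_toLp, LInfty.coeFn_mul (T b) (T c),
        (hmem b).coeFn_toLp, (hmem c).coeFn_toLp] with x h1 h2 h3 h4
      exact h1.trans ((h2.trans (congrArg₂ (· * ·) h3 h4)).symm) with
    map_star' := fun c => Lp.ext <| by
      filter_upwards [(hmem (star c)).coeFn_toLp, LInfty.coeFn_star (T c),
        (hmem c).coeFn_toLp] with x h1 h2 h3
      exact h1.trans ((h2.trans (congrArg star h3)).symm) }

theorem LInfty.coeFn_compStarAlgHom {K : Type*} [TopologicalSpace K] [CompactSpace K] {φ : X → K}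
    (hφ : StronglyMeasurable φ) (c : C(K, A)) :
    ⇑(LInfty.compStarAlgHom μ φ hφ c) =ᵐ[μ] fun x => c (φ x) :=
  MemLp.coeFn_toLp (memLp_top_comp_stronglyMeasurable hφ c)

/-- If `c k ≠ 0`, then `c` has no zero near `k`, and `ψ` takes values near `k` on a set of positive
measure, so `c ∘ φ` is not null. -/
theorem LInfty.compStarAlgHom_injective {ψ : X → A} [CompactSpace (essRange μ ψ)]
    {φ : X → essRange μ ψ} (hφ : StronglyMeasurable φ) (hφψ : (fun x => (φ x : A)) =ᵐ[μ] ψ) :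
    Function.Injective (LInfty.compStarAlgHom (A := A) μ φ hφ) := by
  refine (injective_iff_map_eq_zero _).2 fun c hc => ?_
  have h0 : ∀ᵐ x ∂μ, c (φ x) = 0 := by
    filter_upwards [LInfty.coeFn_compStarAlgHom hφ c, Lp.coeFn_zero A ∞ μ] with x h1 h2
    rw [← h1, hc, h2]
    rfl
  ext k
  by_contra hk
  have hU : {y : essRange μ ψ | c y ≠ 0} ∈ 𝓝 k :=
    (isOpen_ne_fun c.continuous continuous_const).mem_nhds hk
  obtain ⟨V, hV, hVU⟩ := mem_nhds_subtype _ _ _ |>.1 hU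
  refine (k.2 V hV).ne' (measure_mono_null (t := {x | ¬ (c (φ x) = 0 ∧ (φ x : A) = ψ x)})
    (fun x hx hx' => ?_) (ae_iff.1 (h0.and hφψ)))
  refine hVU (a := φ x) ?_ hx'.1
  change (φ x : A) ∈ V
  rw [hx'.2]
  exact hx

end EssRange

/-! ### From essentially bounded functions to matrices -/

theorem QuantumProbabilityMeasure.inducedMeasure_ne_zero {X : Type*} [MeasurableSpace X]
    {H : Type*} [NormedAddCommGroup H] [InnerProductSpace ℂ H] [CompleteSpace H]
    [FiniteDimensional ℂ H] (ν : QuantumProbabilityMeasure X H) : ν.inducedMeasure ≠ 0 := by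
  -- On the zero space the normalised trace would be `0 / 0 = 0`; this case is excluded by `ν(X) ≠
  -- 0`.
  have hnt : Nontrivial H := by
    by_contra h
    rw [not_nontrivial_iff_subsingleton] at h
    exact ν.univ_ne_zero' (Subsingleton.elim _ _)
  have hd : (Module.finrank ℂ H : ℝ) ≠ 0 := Nat.cast_ne_zero.2 Module.finrank_pos.ne'
  intro h
  have h1 := ν.inducedMeasure_apply MeasurableSet.univ
  have h2 : ν.normalizedTrace Set.univ = 1 := by
    rw [QuantumProbabilityMeasure.normalizedTrace, ν.univ_eq_one']
    have : LinearMap.trace ℂ H ((1 : H →L[ℂ] H) : H →ₗ[ℂ] H) = Module.finrank ℂ H :=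
      LinearMap.trace_one ℂ H
    rw [this, Complex.natCast_re, div_self hd]
  rw [h, h2] at h1
  simp at h1

/-- The values of the ⋆-homomorphisms from the C⋆-algebra generated by an essentially bounded
operator valued function form the hypoconvex hull of its essential range. -/
theorem homSpectrum_Lp {X : Type*} [MeasurableSpace X] {μ : Measure X} (hμ : μ ≠ 0) {H : Type*}
    [NormedAddCommGroup H] [InnerProductSpace ℂ H] [CompleteSpace H] [FiniteDimensional ℂ H]
    (ψ : Lp (H →L[ℂ] H) ∞ μ) : homSpectrum (H →L[ℂ] H) ψ = hypoconvexHull (essRange μ ψ) := by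
  have : ProperSpace (H →L[ℂ] H) := FiniteDimensional.proper ℂ _
  have : CompactSpace (essRange μ ψ) := isCompact_iff_compactSpace.1 (isCompact_essRange_Lp ψ)
  have : Nonempty (essRange μ ψ) := (nonempty_essRange_Lp hμ ψ).to_subtype
  obtain ⟨φ, hφ, hφψ⟩ := exists_stronglyMeasurable_essRange hμ ψ
  let f : C(essRange μ ψ, H →L[ℂ] H) := ⟨Subtype.val, continuous_subtype_val⟩
  have hf : LInfty.compStarAlgHom μ φ hφ f = ψ :=
    Lp.ext ((LInfty.coeFn_compStarAlgHom hφ f).trans hφψ)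
  have h1 := homSpectrum_map_of_injective (C := H →L[ℂ] H) (LInfty.compStarAlgHom μ φ hφ)
    (LInfty.compStarAlgHom_injective hφ hφψ) f
  rw [hf, homSpectrum_continuousMap] at h1
  have hrange : Set.range f = essRange μ ψ := Subtype.range_coe
  rw [h1, hrange]

theorem image_gelfandSpectrum {d : ℕ} {A C : Type*} [CStarAlgebra A] [CStarAlgebra C]
    (e : Matrix (Fin d) (Fin d) ℂ ≃⋆ₐ[ℂ] C) (a : A) :
    e '' gelfandSpectrum d a = homSpectrum C a := by
  ext l
  constructor
  · rintro ⟨_, ⟨ρ, rfl⟩, rfl⟩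
    exact ⟨(e : Matrix (Fin d) (Fin d) ℂ →⋆ₐ[ℂ] C).comp ρ, rfl⟩
  · rintro ⟨ρ, rfl⟩
    exact ⟨_, ⟨(e.symm : C →⋆ₐ[ℂ] Matrix (Fin d) (Fin d) ℂ).comp ρ, rfl⟩, e.apply_symm_apply _⟩

theorem mainTheorem1 {X : Type*} [MeasurableSpace X] {H : Type*} [NormedAddCommGroup H]
    [InnerProductSpace ℂ H] [CompleteSpace H] [FiniteDimensional ℂ H]
    (d : ℕ) (hd : Module.finrank ℂ H = d)
    (ν : QuantumProbabilityMeasure X H) (ψ : QuantumLInfty ν) :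
    (∀ l : Matrix (Fin d) (Fin d) ℂ,
      l ∈ gelfandSpectrum d ψ ↔
        ∃ v : EuclideanSpace ℂ (Fin d) ≃ₗᵢ[ℂ] H,
          v.conjStarAlgEquiv (Matrix.toEuclideanCLM (𝕜 := ℂ) l) ∈
            hypoconvexHull (essRange ν.inducedMeasure (ψ : X → (H →L[ℂ] H)))) ∧
    ∀ v : EuclideanSpace ℂ (Fin d) ≃ₗᵢ[ℂ] H,
      (fun l : Matrix (Fin d) (Fin d) ℂ =>
          v.conjStarAlgEquiv (Matrix.toEuclideanCLM (𝕜 := ℂ) l)) '' gelfandSpectrum d ψ =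
        hypoconvexHull (essRange ν.inducedMeasure (ψ : X → (H →L[ℂ] H))) := by
  have key : ∀ v : EuclideanSpace ℂ (Fin d) ≃ₗᵢ[ℂ] H,
      (fun l : Matrix (Fin d) (Fin d) ℂ =>
          v.conjStarAlgEquiv (Matrix.toEuclideanCLM (𝕜 := ℂ) l)) '' gelfandSpectrum d ψ =
        hypoconvexHull (essRange ν.inducedMeasure (ψ : X → (H →L[ℂ] H))) := fun v =>
    (image_gelfandSpectrum
      ((Matrix.toEuclideanCLM (n := Fin d) (𝕜 := ℂ)).trans v.conjStarAlgEquiv) ψ).trans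
      (homSpectrum_Lp ν.inducedMeasure_ne_zero ψ)
  refine ⟨fun l => ⟨fun hl => ?_, fun ⟨v, hv⟩ => ?_⟩, key⟩
  -- Since `key` holds for every unitary, any one serves; an orthonormal basis supplies it.
  · let v := ((stdOrthonormalBasis ℂ H).reindex (finCongr hd)).repr.symm
    refine ⟨v, ?_⟩
    rw [← key v]
    exact ⟨l, hl, rfl⟩
  · rw [← key v] at hv
    obtain ⟨l', hl', h⟩ := hv
    rwa [← (Matrix.toEuclideanCLM (n := Fin d) (𝕜 := ℂ)).injective
      (v.conjStarAlgEquiv.injective h)]
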